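/- **Calculus.** Terms of the untyped probabilistic $\lambda$-calculus are $M ::= x \mid \lambda x.M \mid MM \mid M\oplus M \mid \Omega$, taken up to renaming of bound variables. The affine judgement $\Gamma\vdash M$, with $\Gamma$ a finite set of variables, is given by the rules: $\Gamma,x\vdash x$; $\Gamma\vdash\Omega$; if $\Gamma,x\vdash M$ then $\Gamma\vdash\lambda x.M$; if $\Gamma\vdash M$, $\Delta\vdash N$ and $\Gamma\cap\Delta=\emptyset$ then $\Gamma\cup\Delta\vdash MN$; if $\Gamma\vdash M$ and $\Gamma\vdash N$ then $\Gamma\vdash M\oplus N$. A *program* is a term $M$ with $\emptyset\vdash M$, and a *value* is a program of the form $\lambda x.M$. **Semantics.** The call-by-value evaluation relation $M\Downarrow\mathscr D$ between programs and value subdistributions is defined inductively: $\Omega\Downarrow 0$; $V\Downarrow\delta_V$ (the Dirac distribution) for a value $V$; if $M\Downarrow\mathscr D$ and $N\Downarrow\mathscr E$ then $M\oplus N\Downarrow\frac12\mathscr D+\frac12\mathscr E$; if $M\Downarrow\mathscr D$, $N\Downarrow\mathscr E$, and $L\{V/x\}\Downarrow\mathscr F_{L,V}$ for all $\lambda x.L\in\mathrm{supp}(\mathscr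 D)$ and $V\in\mathrm{supp}(\mathscr E)$, then $MN\Downarrow\sum_{\lambda x.L,\,V}\mathscr D(\lambda x.L)\,\mathscr E(V)\,\mathscr F_{L,V}$. For every program $M$ there is exactly one $\mathscr D$ with $M\Downarrow\mathscr D$; it is finitely supported and is written $[\![M]\!]$. **Trace distance.** A *trace* is a finite (possibly empty) sequence $s=V_1\cdots V_n$ of values. The probability $\Pr(M,s)$ that a program $M$ accepts $s$ is defined by $\Pr(\lambda x.M,\epsilon)=1$, $\Pr(\lambda x.M,V\cdot s)=\Pr(M\{V/x\},s)$, and $\Pr(M,s)=\sum_V[\![M]\!](V)\,\Pr(V,s)$ if $M$ is not a value. The *trace distance* between programs $M$ and $N$ is $\delta^{\mathrm{tr}}(M,N)=\sup_s|\Pr(M,s)-\Pr(N,s)|$, the supremum being over all traces $s$. **Contexts.** Contexts are $\mathcal C ::= [\cdot]\mid M\mid\lambda x.\mathcal C\mid\mathcal C M\mid M\mathcal C\mid\mathcal C\oplus\mathcal C$, where $M$ ranges over terms. The judgement $\Gamma\vdash\mathcal C$ is defined by $\Gamma\vdash[\cdot]$ for every $\Gamma$ together with the same rules as for terms. An *affine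 context* is a context $\mathcal C$ with $\emptyset\vdash\mathcal C$, and $\mathcal C[M]$ is the program obtained by replacing the hole $[\cdot]$ by the program $M$. **Theorem.** The trace distance is non-expansive: for all programs $M$ and $N$ and every affine context $\mathcal C$, $$\delta^{\mathrm{tr}}(\mathcal C[M],\mathcal C[N])\;\le\;\delta^{\mathrm{tr}}(M,N).$$ -/

import Mathlib

namespace AffineLambda

/-! ### Terms and the affine discipline -/

/-- Terms of the untyped probabilistic lambda-calculus with an explicit divergent term, up to
renaming of bound variables (de Bruijn indices): `choice M N` is the fair choice `M ⊕ N`, and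
`omega` is the divergent term. -/
inductive Term : Type
  | var : ℕ → Term
  | lam : Term → Term
  | app : Term → Term → Term
  | choice : Term → Term → Term
  | omega : Term

/-- The affine judgement `Γ ⊢ M`, where `Γ` is a finite set of variables. Below a binder the bound
variable is `0` and the variables of `Γ` are shifted by one. -/
inductive Term.Affine : Finset ℕ → Term → Prop
  | var {Γ : Finset ℕ} {n : ℕ} : n ∈ Γ → Term.Affine Γ (Term.var n)
  | lam {Γ : Finset ℕ} {M : Term} :
      Term.Affine (insert 0 (Γ.image Nat.succ)) M → Term.Affine Γ (Term.lam M)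
  | app {Γ Δ : Finset ℕ} {M N : Term} : Disjoint Γ Δ →
      Term.Affine Γ M → Term.Affine Δ N → Term.Affine (Γ ∪ Δ) (Term.app M N)
  | choice {Γ : Finset ℕ} {M N : Term} :
      Term.Affine Γ M → Term.Affine Γ N → Term.Affine Γ (Term.choice M N)
  | omega {Γ : Finset ℕ} : Term.Affine Γ Term.omega

/-- Substitution of the *closed* term `V` for the variable `k` (the variables above `k` go down by
one, since the binder of `k` disappears). As `V` is closed, it is not shifted below binders. -/
def Term.subst (V : Term) : ℕ → Term → Term
  | k, .var n => if n = k then V else if k < n then .var (n - 1) else .var n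
  | k, .lam M => .lam (Term.subst V (k + 1) M)
  | k, .app M N => .app (Term.subst V k M) (Term.subst V k N)
  | k, .choice M N => .choice (Term.subst V k M) (Term.subst V k N)
  | _, .omega => .omega

theorem Term.Affine.mono {Γ : Finset ℕ} {M : Term} (h : M.Affine Γ) :
    ∀ {Δ : Finset ℕ}, Γ ⊆ Δ → M.Affine Δ := by
  induction h with
  | var hn => intro Δ hΔ; exact .var (hΔ hn)
  | lam _ ih =>
    intro Δ hΔ
    exact .lam (ih (Finset.insert_subset_insert _ (Finset.image_subset_image hΔ)))
  | @app Γ₁ Γ₂ M N hd _ _ ihM ihN =>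
    intro Δ hΔ
    have h1 : Γ₁ ⊆ Δ \ Γ₂ := by
      intro a ha
      rw [Finset.mem_sdiff]
      exact ⟨hΔ (Finset.mem_union_left _ ha), Finset.disjoint_left.1 hd ha⟩
    have h2 : Γ₂ ⊆ Δ := fun a ha => hΔ (Finset.mem_union_right _ ha)
    have h3 := Term.Affine.app (Finset.sdiff_disjoint) (ihM h1) (ihN (Finset.Subset.refl Γ₂))
    rwa [Finset.sdiff_union_of_subset h2] at h3
  | choice _ _ ihM ihN => intro Δ hΔ; exact .choice (ihM hΔ) (ihN hΔ)
  | omega => intro Δ _; exact .omega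

/-- Effect of substituting for the variable `k` on the name of a variable other than `k`. -/
def dropVar (k n : ℕ) : ℕ := if k < n then n - 1 else n

theorem Term.Affine.subst {Γ : Finset ℕ} {M V : Term} (h : M.Affine Γ) (hV : V.Affine ∅) :
    ∀ k : ℕ, (Term.subst V k M).Affine ((Γ.erase k).image (dropVar k)) := by
  induction h with
  | @var Γ n hn =>
    intro k
    by_cases hk : n = k
    · simp only [Term.subst, hk, if_true]
      exact hV.mono (Finset.empty_subset _)
    · have : Term.subst V k (.var n) = .var (dropVar k n) := by
        simp only [Term.subst, dropVar, hk, if_false]; split_ifs <;> rfl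
      rw [this]
      exact .var (Finset.mem_image_of_mem _ (Finset.mem_erase.2 ⟨hk, hn⟩))
  | @lam Γ M _ ih =>
    intro k
    refine .lam ((ih (k + 1)).mono ?_)
    intro a ha
    simp only [Finset.mem_image, Finset.mem_erase, Finset.mem_insert] at ha ⊢
    obtain ⟨b, ⟨hb, rfl | ⟨c, hc, rfl⟩⟩, rfl⟩ := ha
    · left; simp [dropVar]
    · right
      refine ⟨dropVar k c, ⟨c, ⟨fun e => hb (by simp [e]), hc⟩, rfl⟩, ?_⟩
      simp only [dropVar]; split_ifs <;> omega
  | @app Γ₁ Γ₂ M N hd _ _ ihM ihN =>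
    intro k
    rw [Finset.erase_union_distrib, Finset.image_union]
    refine .app ?_ (ihM k) (ihN k)
    rw [Finset.disjoint_left]
    intro a h1 h2
    simp only [Finset.mem_image, Finset.mem_erase] at h1 h2
    obtain ⟨b, ⟨hb, hb1⟩, rfl⟩ := h1
    obtain ⟨c, ⟨hc, hc1⟩, e⟩ := h2
    have : c = b := by
      simp only [dropVar] at e; split_ifs at e <;> omega
    exact Finset.disjoint_left.1 hd hb1 (this ▸ hc1)
  | choice _ _ ihM ihN => intro k; exact .choice (ihM k) (ihN k)
  | omega => intro k; exact .omega

/-! ### Programs and values -/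

/-- A program is a closed affine term. -/
abbrev Program : Type := {M : Term // M.Affine ∅}

/-- A value is a program of the form `λx. body`. -/
@[ext] structure Value : Type where
  body : Term
  affine : body.Affine {0}

namespace Program

def omega : Program := ⟨.omega, .omega⟩

def choice (M N : Program) : Program := ⟨.choice M.1 N.1, .choice M.2 N.2⟩

def app (M N : Program) : Program :=
  ⟨.app M.1 N.1, by simpa using Term.Affine.app (Finset.disjoint_empty_left ∅) M.2 N.2⟩

end Program

namespace Value

/-- The program `λx. body`. -/
def toProgram (V : Value) : Program := ⟨.lam V.body, .lam (by simpa using V.affine)⟩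

/-- For `U = λx. L`, the program `L{V/x}`. -/
def apply (U V : Value) : Program :=
  ⟨Term.subst V.toProgram.1 0 U.body, by
    have h := U.affine.subst V.toProgram.2 0
    simpa using h⟩

theorem toProgram_injective : Function.Injective toProgram := by
  intro U V h
  have := congrArg Subtype.val h
  simp only [toProgram, Term.lam.injEq] at this
  exact Value.ext this

end Value

def Program.IsValue (M : Program) : Prop := ∃ V : Value, V.toProgram = M

/-! ### Big-step semantics -/

/-- Big-step evaluation `M ⇓ D` of a program to a (finitely supported) value subdistribution. -/
inductive BigStep : Program → (Value →₀ ℝ) → Prop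
  | omega : BigStep Program.omega 0
  | value (V : Value) : BigStep V.toProgram (Finsupp.single V 1)
  | choice {M N : Program} {D E : Value →₀ ℝ} : BigStep M D → BigStep N E →
      BigStep (Program.choice M N) ((1 / 2 : ℝ) • D + (1 / 2 : ℝ) • E)
  | app {M N : Program} {D E : Value →₀ ℝ} (F : Value → Value → (Value →₀ ℝ)) :
      BigStep M D → BigStep N E →
      (∀ U ∈ D.support, ∀ V ∈ E.support, BigStep (U.apply V) (F U V)) →
      BigStep (Program.app M N)
        (∑ U ∈ D.support, ∑ V ∈ E.support, (D U * E V) • F U V)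

/-- Every distribution obtained by evaluation is nonnegative and has weight at most one. -/
theorem BigStep.subdistribution {M : Program} {D : Value →₀ ℝ} (h : BigStep M D) :
    (∀ V, 0 ≤ D V) ∧ ∑ V ∈ D.support, D V ≤ 1 := by
  suffices H : (∀ V, 0 ≤ D V) ∧ D.sum (fun _ p => p) ≤ 1 from H
  have hadd : ∀ D E : Value →₀ ℝ, (D + E).sum (fun _ p => p)
      = D.sum (fun _ p => p) + E.sum (fun _ p => p) := fun D E =>
    Finsupp.sum_add_index' (fun _ => rfl) (fun _ _ _ => rfl)
  have hsmul : ∀ (c : ℝ) (D : Value →₀ ℝ), (c • D).sum (fun _ p => p)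
      = c * D.sum (fun _ p => p) := fun c D => by
    rw [Finsupp.sum_smul_index (fun _ => rfl)]
    simp only [Finsupp.sum, Finset.mul_sum]
  let w : (Value →₀ ℝ) →+ ℝ :=
    { toFun := fun D => D.sum (fun _ p => p), map_zero' := Finsupp.sum_zero_index, map_add' := hadd }
  have hw : ∀ D, w D = D.sum (fun _ p => p) := fun _ => rfl
  induction h with
  | omega => simp
  | value V =>
    classical
    refine ⟨fun W => ?_, by simp⟩
    rw [Finsupp.single_apply]; split_ifs <;> norm_num
  | @choice M N D E _ _ ihD ihE =>
    refine ⟨fun V => ?_, ?_⟩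
    · have h1 := ihD.1 V
      have h2 := ihE.1 V
      simp only [Finsupp.add_apply, Finsupp.smul_apply, smul_eq_mul]
      positivity
    · rw [hadd, hsmul, hsmul]
      linarith [ihD.2, ihE.2]
  | @app M N D E F _ _ _ ihD ihE ihF =>
    refine ⟨fun W => ?_, ?_⟩
    · simp only [Finsupp.finsetSum_apply, Finsupp.smul_apply, smul_eq_mul]
      exact Finset.sum_nonneg fun U hU => Finset.sum_nonneg fun V hV =>
        mul_nonneg (mul_nonneg (ihD.1 U) (ihE.1 V)) ((ihF U hU V hV).1 W)
    · rw [← hw, map_sum]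
      calc ∑ U ∈ D.support, w (∑ V ∈ E.support, (D U * E V) • F U V)
          ≤ ∑ U ∈ D.support, D U := by
            refine Finset.sum_le_sum fun U hU => ?_
            rw [map_sum]
            calc ∑ V ∈ E.support, w ((D U * E V) • F U V)
                ≤ ∑ V ∈ E.support, D U * E V := by
                  refine Finset.sum_le_sum fun V hV => ?_
                  rw [hw, hsmul]
                  exact mul_le_of_le_one_right (mul_nonneg (ihD.1 U) (ihE.1 V)) (ihF U hU V hV).2
              _ = D U * E.sum (fun _ p => p) := by rw [Finsupp.sum, Finset.mul_sum]
              _ ≤ D U := mul_le_of_le_one_right (ihD.1 U) ihE.2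
        _ ≤ 1 := ihD.2

theorem BigStep.unique {M : Program} {D : Value →₀ ℝ} (h : BigStep M D) :
    ∀ {D' : Value →₀ ℝ}, BigStep M D' → D' = D := by
  induction h with
  | omega =>
    intro D' h'
    generalize hP : Program.omega = P at h'
    cases h' <;> first | rfl | (have := congrArg Subtype.val hP; cases this)
  | value V =>
    intro D' h'
    generalize hP : V.toProgram = P at h'
    cases h' with
    | value W => rw [Value.toProgram_injective hP]
    | omega => have := congrArg Subtype.val hP; cases this
    | choice _ _ => have := congrArg Subtype.val hP; cases this
    | app _ _ _ _ => have := congrArg Subtype.val hP; cases this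
  | @choice M N D E _ _ ihD ihE =>
    intro D' h'
    generalize hP : Program.choice M N = P at h'
    cases h' with
    | @choice M' N' D₁ E₁ h1 h2 =>
      have hv := congrArg Subtype.val hP
      simp only [Program.choice, Term.choice.injEq] at hv
      obtain rfl := Subtype.ext hv.1
      obtain rfl := Subtype.ext hv.2
      rw [ihD h1, ihE h2]
    | omega => have := congrArg Subtype.val hP; cases this
    | value _ => have := congrArg Subtype.val hP; cases this
    | app _ _ _ _ => have := congrArg Subtype.val hP; cases this
  | @app M N D E F _ _ _ ihD ihE ihF =>
    intro D' h'
    generalize hP : Program.app M N = P at h'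
    cases h' with
    | @app M' N' D₁ E₁ F₁ h1 h2 h3 =>
      have hv := congrArg Subtype.val hP
      simp only [Program.app, Term.app.injEq] at hv
      obtain rfl := Subtype.ext hv.1
      obtain rfl := Subtype.ext hv.2
      obtain rfl := ihD h1
      obtain rfl := ihE h2
      refine Finset.sum_congr rfl fun U hU => Finset.sum_congr rfl fun V hV => ?_
      rw [ihF U hU V hV (h3 U hU V hV)]
    | omega => have := congrArg Subtype.val hP; cases this
    | value _ => have := congrArg Subtype.val hP; cases this
    | choice _ _ => have := congrArg Subtype.val hP; cases this

def Term.size : Term → ℕ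
  | .var _ => 1
  | .lam M => M.size + 1
  | .app M N => M.size + N.size + 1
  | .choice M N => max M.size N.size + 1
  | .omega => 1

theorem Term.Affine.size_subst {Γ : Finset ℕ} {M : Term} (V : Term) (h : M.Affine Γ) :
    ∀ k : ℕ, (Term.subst V k M).size ≤ M.size + (if k ∈ Γ then V.size else 0) := by
  induction h with
  | @var Γ n hn =>
    intro k
    by_cases hk : n = k
    · subst hk; simp [Term.subst, hn]
    · simp only [Term.subst, hk, if_false]; split_ifs <;> simp [Term.size]
  | @lam Γ M _ ih =>
    intro k
    have := ih (k + 1)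
    simp only [Finset.mem_insert, Finset.mem_image, Nat.succ_eq_add_one, Nat.add_right_cancel_iff,
      exists_eq_right, Nat.add_eq_zero_iff, one_ne_zero, and_false, false_or] at this
    simp only [Term.subst, Term.size]; omega
  | @app Γ₁ Γ₂ M N hd _ _ ihM ihN =>
    intro k
    have h1 := ihM k
    have h2 := ihN k
    have h3 : ¬ (k ∈ Γ₁ ∧ k ∈ Γ₂) := fun h => Finset.disjoint_left.1 hd h.1 h.2
    simp only [Term.subst, Term.size, Finset.mem_union]
    by_cases hk1 : k ∈ Γ₁ <;> by_cases hk2 : k ∈ Γ₂ <;> simp_all <;> omega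
  | choice _ _ ihM ihN =>
    intro k
    have h1 := ihM k
    have h2 := ihN k
    simp only [Term.subst, Term.size]; omega
  | omega => intro k; simp [Term.subst, Term.size]

theorem exists_bigStep (n : ℕ) : ∀ M : Program, M.1.size ≤ n →
    ∃ D, BigStep M D ∧ ∀ V ∈ D.support, V.toProgram.1.size ≤ M.1.size := by
  induction n with
  | zero => rintro ⟨M, hM⟩ h; cases M <;> simp [Term.size] at h
  | succ n ih =>
    rintro ⟨M, hM⟩ hn
    cases M with
    | var i =>
      exfalso
      clear hn
      generalize hΓ : (∅ : Finset ℕ) = Γ at hM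
      cases hM with | var h => subst hΓ; simp at h
    | omega => exact ⟨0, .omega, by simp⟩
    | lam L =>
      have hL : L.Affine {0} := by
        generalize hΓ : (∅ : Finset ℕ) = Γ at hM
        cases hM with | lam h => subst hΓ; simpa using h
      refine ⟨_, .value ⟨L, hL⟩, fun V hV => ?_⟩
      have : V = ⟨L, hL⟩ := by
        classical
        exact Finset.mem_singleton.1 (Finsupp.support_single_subset hV)
      subst this; exact le_rfl
    | choice M N =>
      have hMN : M.Affine ∅ ∧ N.Affine ∅ := by
        generalize hΓ : (∅ : Finset ℕ) = Γ at hM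
        cases hM with | choice h1 h2 => subst hΓ; exact ⟨h1, h2⟩
      simp only [Term.size] at hn
      obtain ⟨D, hD, sD⟩ := ih ⟨M, hMN.1⟩ (by simp only; omega)
      obtain ⟨E, hE, sE⟩ := ih ⟨N, hMN.2⟩ (by simp only; omega)
      refine ⟨_, .choice hD hE, fun V hV => ?_⟩
      simp only [Term.size]
      by_cases h1 : V ∈ D.support
      · have := sD V h1; simp only at this; omega
      · by_cases h2 : V ∈ E.support
        · have := sE V h2; simp only at this; omega
        · simp only [Finsupp.mem_support_iff, not_not] at h1 h2
          simp [h1, h2] at hV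
    | app M N =>
      have hMN : M.Affine ∅ ∧ N.Affine ∅ := by
        generalize hΓ : (∅ : Finset ℕ) = Γ at hM
        cases hM with
        | app _ h1 h2 =>
          obtain ⟨e1, e2⟩ := Finset.union_eq_empty.1 hΓ.symm
          subst e1; subst e2; exact ⟨h1, h2⟩
      simp only [Term.size] at hn
      obtain ⟨D, hD, sD⟩ := ih ⟨M, hMN.1⟩ (by simp only; omega)
      obtain ⟨E, hE, sE⟩ := ih ⟨N, hMN.2⟩ (by simp only; omega)
      have key : ∀ U ∈ D.support, ∀ V ∈ E.support, (U.apply V).1.size ≤ M.size + N.size := by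
        intro U hU V hV
        have h1 := sD U hU
        have h2 := sE V hV
        have h3 := U.affine.size_subst V.toProgram.1 0
        simp only [Value.apply, Finset.mem_singleton, if_true] at h3 ⊢
        simp only [Value.toProgram, Term.size] at h1 h2 h3 ⊢
        omega
      have hF : ∀ U V, ∃ F : Value →₀ ℝ, U ∈ D.support → V ∈ E.support →
          BigStep (U.apply V) F ∧ ∀ W ∈ F.support, W.toProgram.1.size ≤ M.size + N.size := by
        intro U V
        by_cases h : U ∈ D.support ∧ V ∈ E.support
        · have hk := key U h.1 V h.2
          obtain ⟨F, hF, sF⟩ := ih (U.apply V) (by omega)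
          exact ⟨F, fun _ _ => ⟨hF, fun W hW => (sF W hW).trans hk⟩⟩
        · exact ⟨0, fun h1 h2 => absurd ⟨h1, h2⟩ h⟩
      choose F hF using hF
      refine ⟨_, .app F hD hE fun U hU V hV => (hF U V hU hV).1, fun W hW => ?_⟩
      simp only [Term.size]
      by_contra hlt
      refine Finsupp.mem_support_iff.1 hW ?_
      simp only [Finsupp.finsetSum_apply, Finsupp.smul_apply, smul_eq_mul]
      refine Finset.sum_eq_zero fun U hU => Finset.sum_eq_zero fun V hV => ?_
      have : F U V W = 0 := by
        by_contra hne
        have := (hF U V hU hV).2 W (Finsupp.mem_support_iff.2 hne)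
        omega
      rw [this, mul_zero]

/-- Every program evaluates to exactly one value distribution. -/
theorem existsUnique_bigStep (M : Program) : ∃! D, BigStep M D := by
  obtain ⟨D, hD, _⟩ := exists_bigStep _ M le_rfl
  exact ⟨D, hD, fun D' h' => hD.unique h'⟩

/-- The semantics `⟦M⟧` of a program: the unique value distribution to which it evaluates. -/
noncomputable def sem (M : Program) : Value →₀ ℝ := (existsUnique_bigStep M).choose

theorem sem_spec (M : Program) : BigStep M (sem M) := (existsUnique_bigStep M).choose_spec.1

/-! ### Traces and the trace distance -/

/-- A trace is a finite sequence of values, the arguments passed one after the other. -/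
abbrev Trace : Type := List Value

open Classical in
/-- The probability that a program accepts a trace. -/
noncomputable def prob (M : Program) (s : Trace) : ℝ :=
  if hM : M.IsValue then
    match s with
    | [] => 1
    | V :: t => prob (hM.choose.apply V) t
  else ∑ V ∈ (sem M).support, sem M V * prob V.toProgram s
termination_by (s.length, if M.IsValue then 0 else 1)
decreasing_by
  · left; simp
  · have hV : V.toProgram.IsValue := ⟨V, rfl⟩
    simp only [hM, hV, if_true, if_false]
    exact Prod.Lex.right _ Nat.zero_lt_one

theorem prob_value_nil (U : Value) : prob U.toProgram [] = 1 := by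
  have hU : U.toProgram.IsValue := ⟨U, rfl⟩
  rw [prob, dif_pos hU]

theorem prob_value_cons (U V : Value) (s : Trace) :
    prob U.toProgram (V :: s) = prob (U.apply V) s := by
  have hU : U.toProgram.IsValue := ⟨U, rfl⟩
  rw [prob, dif_pos hU]
  simp only [Value.toProgram_injective hU.choose_spec]

theorem prob_of_not_isValue {M : Program} (hM : ¬ M.IsValue) (s : Trace) :
    prob M s = ∑ V ∈ (sem M).support, sem M V * prob V.toProgram s := by
  rw [prob, dif_neg hM]

/-- Acceptance probabilities lie in `[0, 1]`, so that the supremum below is a genuine one. -/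
theorem prob_mem_Icc (M : Program) (s : Trace) : prob M s ∈ Set.Icc (0 : ℝ) 1 := by
  induction s generalizing M with
  | nil =>
    by_cases hM : M.IsValue
    · obtain ⟨U, rfl⟩ := hM
      rw [prob_value_nil]; norm_num
    · have h := (sem_spec M).subdistribution
      rw [prob_of_not_isValue hM]
      simp only [prob_value_nil, mul_one]
      exact ⟨Finset.sum_nonneg fun V _ => h.1 V, h.2⟩
  | cons W s ih =>
    by_cases hM : M.IsValue
    · obtain ⟨U, rfl⟩ := hM
      rw [prob_value_cons]; exact ih _
    · have h := (sem_spec M).subdistribution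
      rw [prob_of_not_isValue hM]
      simp only [prob_value_cons]
      exact ⟨Finset.sum_nonneg fun V _ => mul_nonneg (h.1 V) (ih _).1,
        (Finset.sum_le_sum fun V _ => mul_le_of_le_one_right (h.1 V) (ih _).2).trans h.2⟩

/-- The trace distance. -/
noncomputable def traceDist (M N : Program) : ℝ := ⨆ s : Trace, |prob M s - prob N s|

/-! ### Contexts -/

/-- Contexts: `C ::= [·] | M | λx.C | C M | M C | C ⊕ C`. -/
inductive RawCtx : Type
  | hole : RawCtx
  | term : Term → RawCtx
  | lam : RawCtx → RawCtx
  | appLeft : RawCtx → Term → RawCtx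
  | appRight : Term → RawCtx → RawCtx
  | choice : RawCtx → RawCtx → RawCtx

/-- The affine judgement for contexts. -/
inductive RawCtx.Affine : Finset ℕ → RawCtx → Prop
  | hole {Γ : Finset ℕ} : RawCtx.Affine Γ RawCtx.hole
  | term {Γ : Finset ℕ} {M : Term} : M.Affine Γ → RawCtx.Affine Γ (RawCtx.term M)
  | lam {Γ : Finset ℕ} {C : RawCtx} :
      RawCtx.Affine (insert 0 (Γ.image Nat.succ)) C → RawCtx.Affine Γ (RawCtx.lam C)
  | appLeft {Γ Δ : Finset ℕ} {C : RawCtx} {M : Term} : Disjoint Γ Δ →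
      RawCtx.Affine Γ C → M.Affine Δ → RawCtx.Affine (Γ ∪ Δ) (RawCtx.appLeft C M)
  | appRight {Γ Δ : Finset ℕ} {M : Term} {C : RawCtx} : Disjoint Γ Δ →
      M.Affine Γ → RawCtx.Affine Δ C → RawCtx.Affine (Γ ∪ Δ) (RawCtx.appRight M C)
  | choice {Γ : Finset ℕ} {C C' : RawCtx} :
      RawCtx.Affine Γ C → RawCtx.Affine Γ C' → RawCtx.Affine Γ (RawCtx.choice C C')

/-- Replacement of the hole by a closed term. -/
def RawCtx.fill : RawCtx → Term → Term
  | .hole, P => P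
  | .term M, _ => M
  | .lam C, P => .lam (C.fill P)
  | .appLeft C M, P => .app (C.fill P) M
  | .appRight M C, P => .app M (C.fill P)
  | .choice C C', P => .choice (C.fill P) (C'.fill P)

theorem RawCtx.Affine.fill {Γ : Finset ℕ} {C : RawCtx} (h : C.Affine Γ) {P : Term}
    (hP : P.Affine ∅) : (C.fill P).Affine Γ := by
  induction h with
  | hole => exact hP.mono (Finset.empty_subset _)
  | term h => exact h
  | lam _ ih => exact .lam ih
  | appLeft hd _ hM ih => exact .app hd ih hM
  | appRight hd hM _ ih => exact .app hd hM ih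
  | choice _ _ ih ih' => exact .choice ih ih'

/-- An affine context without free variables: its filling with a program is a program. -/
abbrev Ctx : Type := {C : RawCtx // C.Affine ∅}

/-- The program `C[M]`. -/
def Ctx.fill (C : Ctx) (M : Program) : Program := ⟨C.1.fill M.1, C.2.fill M.2⟩

end AffineLambda

namespace AffineLambda

/-! ### Expectations under the semantics -/

/-! Call a function of a program a test if it is a convex combination of `0`, `1` and acceptance
probabilities of traces. The map `f ↦ f M - f N` is linear, vanishes on constants and is bounded by
the trace distance on each trace, so no test separates `M` and `N` by more than their trace distance
(`abs_sub_le_traceDist_of_mem_tests`). It therefore suffices that `M ↦ Pr(C[M], s)` is a test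
(`prob_fill_mem_tests`).

The induction needs a more general claim, `expect_fill_mem_tests`: the expectation of `g` under
`⟦C[M]⟧` is a test in `M`, provided that `g` is itself a combination of traces and `g(K[M])` is a
test in `M` for value contexts `K` up to the size of `C`. The induction is on the size of `C`. In an
application, the argument or the function is absorbed into a new `g`; the conditions on this `g`
concern contexts obtained by substitution, to which the induction hypothesis applies.

Affinity enters twice. Evaluation and substitution copy nothing except across the branches of a
choice, where size is a maximum, so the new contexts are smaller. And substituting `K[M]` for a
variable puts `M` on at most one side of each application, so the result is again a context applied
to `M` (`Term.Affine.exists_ctx_subst`). -/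

theorem BigStep.sem_eq {M : Program} {D : Value →₀ ℝ} (h : BigStep M D) : sem M = D :=
  h.unique (sem_spec M)

/-- Affine evaluation never increases size. This keeps the contexts arising in an application below
the size of that application. -/
theorem size_le_of_mem_support_sem {M : Program} {V : Value} (hV : V ∈ (sem M).support) :
    V.body.size + 1 ≤ M.1.size := by
  obtain ⟨D, hD, h⟩ := exists_bigStep _ M le_rfl
  rw [hD.sem_eq] at hV
  exact h V hV

/-- The expectation of `g` under the semantics of a program, as a linear function of `g`. -/
noncomputable def expect : (Value → ℝ) →ₗ[ℝ] (Program → ℝ) where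
  toFun g M := ∑ V ∈ (sem M).support, sem M V * g V
  map_add' g h := by
    funext M
    simp only [Pi.add_apply, mul_add, Finset.sum_add_distrib]
  map_smul' c g := by
    funext M
    simp only [Pi.smul_apply, smul_eq_mul, RingHom.id_apply, Finset.mul_sum]
    exact Finset.sum_congr rfl fun V _ => by ring

theorem expect_apply (g : Value → ℝ) (M : Program) :
    expect g M = ∑ V ∈ (sem M).support, sem M V * g V := rfl

theorem expect_eq_linearCombination (g : Value → ℝ) (M : Program) :
    expect g M = Finsupp.linearCombination ℝ g (sem M) := rfl

theorem expect_toProgram (g : Value → ℝ) (V : Value) : expect g V.toProgram = g V := by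
  rw [expect_eq_linearCombination, (BigStep.value V).sem_eq]
  simp

theorem expect_choice (g : Value → ℝ) (M N : Program) :
    expect g (M.choice N) = (1 / 2 : ℝ) * expect g M + (1 / 2 : ℝ) * expect g N := by
  simp only [expect_eq_linearCombination, (BigStep.choice (sem_spec M) (sem_spec N)).sem_eq,
    map_add, map_smul, smul_eq_mul]

theorem expect_app (g : Value → ℝ) (M N : Program) :
    expect g (M.app N) = ∑ U ∈ (sem M).support, ∑ V ∈ (sem N).support,
      (sem M U * sem N V) * expect g (U.apply V) := by
  have h := (BigStep.app (fun U V => sem (U.apply V)) (sem_spec M) (sem_spec N)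
    fun U _ V _ => sem_spec (U.apply V)).sem_eq
  simp only [expect_eq_linearCombination, h, map_sum, map_smul, smul_eq_mul]

/-- Evaluation of an application as an iterated expectation, the form in which either side can be
absorbed into the function being averaged. -/
theorem expect_app_left (g : Value → ℝ) (M N : Program) :
    expect g (M.app N) = expect (fun U => expect (fun V => expect g (U.apply V)) N) M := by
  simp only [expect_app, expect_apply _ M, expect_apply _ N, Finset.mul_sum, mul_assoc]

/-- The semantics of a value is Dirac, so the defining formula for non-values holds for every
program. -/
theorem prob_eq_expect (M : Program) (s : Trace) :
    prob M s = expect (fun V => prob V.toProgram s) M := by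
  by_cases hM : M.IsValue
  · obtain ⟨U, rfl⟩ := hM
    rw [expect_toProgram]
  · exact prob_of_not_isValue hM s

/-! ### Tests -/

/-- Subconvex combinations of constants and of acceptance probabilities of traces. -/
def tests : Set (Program → ℝ) :=
  convexHull ℝ (insert 0 (insert 1 (Set.range fun (s : Trace) (M : Program) => prob M s)))

/-- Subconvex combinations of acceptance probabilities of traces, as functions on values. -/
def valueTests : Set (Value → ℝ) :=
  convexHull ℝ (insert 0 (Set.range fun (s : Trace) (V : Value) => prob V.toProgram s))

/-- The missing mass goes to `0`; this matches evaluation, whose weights may sum to less than one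
because of divergence. -/
theorem _root_.Convex.sum_smul_mem_of_sum_le_one {E ι : Type*} [AddCommGroup E] [Module ℝ E]
    {S : Set E} (hS : Convex ℝ S) (h0 : (0 : E) ∈ S) {t : Finset ι} {w : ι → ℝ} {f : ι → E}
    (hw : ∀ i ∈ t, 0 ≤ w i) (hw1 : ∑ i ∈ t, w i ≤ 1) (hf : ∀ i ∈ t, f i ∈ S) :
    ∑ i ∈ t, w i • f i ∈ S := by
  rcases (Finset.sum_nonneg hw).eq_or_lt with h | h
  · rw [Finset.sum_eq_zero fun i hi => by
      rw [(Finset.sum_eq_zero_iff_of_nonneg hw).1 h.symm i hi, zero_smul]]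
    exact h0
  · have := hS.smul_mem_of_zero_mem h0 (hS.centerMass_mem hw h hf) ⟨h.le, hw1⟩
    rwa [Finset.centerMass, smul_inv_smul₀ h.ne'] at this

theorem convex_tests : Convex ℝ tests := convex_convexHull _ _

theorem convex_valueTests : Convex ℝ valueTests := convex_convexHull _ _

theorem zero_mem_tests : (0 : Program → ℝ) ∈ tests :=
  subset_convexHull _ _ (Set.mem_insert _ _)

theorem one_mem_tests : (1 : Program → ℝ) ∈ tests :=
  subset_convexHull _ _ (Set.mem_insert_of_mem _ (Set.mem_insert _ _))

theorem prob_mem_tests (s : Trace) : (fun M => prob M s) ∈ tests :=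
  subset_convexHull _ _ (Set.mem_insert_of_mem _ (Set.mem_insert_of_mem _ ⟨s, rfl⟩))

theorem zero_mem_valueTests : (0 : Value → ℝ) ∈ valueTests :=
  subset_convexHull _ _ (Set.mem_insert _ _)

theorem prob_mem_valueTests (s : Trace) : (fun V : Value => prob V.toProgram s) ∈ valueTests :=
  subset_convexHull _ _ (Set.mem_insert_of_mem _ ⟨s, rfl⟩)

theorem const_mem_tests {c : ℝ} (hc : c ∈ Set.Icc (0 : ℝ) 1) : (fun _ : Program => c) ∈ tests := by
  have := convex_tests.smul_mem_of_zero_mem zero_mem_tests one_mem_tests hc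
  convert this using 1
  funext M
  simp

/-- On values the constant `1` is the acceptance probability of the empty trace, so it needs no
separate generator. -/
theorem comp_toProgram_mem_valueTests {f : Program → ℝ} (hf : f ∈ tests) :
    (fun V : Value => f V.toProgram) ∈ valueTests := by
  refine convexHull_min (t := (LinearMap.funLeft ℝ ℝ Value.toProgram) ⁻¹' valueTests) ?_
    (convex_valueTests.linear_preimage _) hf
  rintro _ (rfl | rfl | ⟨s, rfl⟩)
  · exact zero_mem_valueTests
  · have h := prob_mem_valueTests []
    simp only [prob_value_nil] at h
    exact h
  · exact prob_mem_valueTests s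

theorem expect_mem_tests {g : Value → ℝ} (hg : g ∈ valueTests) : expect g ∈ tests := by
  refine convexHull_min (t := expect ⁻¹' tests) ?_ (convex_tests.linear_preimage _) hg
  rintro _ (rfl | ⟨s, rfl⟩)
  · rw [Set.mem_preimage, map_zero]
    exact zero_mem_tests
  · rw [Set.mem_preimage, ← funext fun M => prob_eq_expect M s]
    exact prob_mem_tests s

/-- Passing the argument `V` first turns the trace `s` into `V :: s`; linearity extends this from
generators to the hull. -/
theorem expect_apply_mem_valueTests {g : Value → ℝ} (hg : g ∈ valueTests) (V : Value) :
    (fun U : Value => expect g (U.apply V)) ∈ valueTests := by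
  refine convexHull_min
    (t := (LinearMap.funLeft ℝ ℝ (fun U : Value => U.apply V) ∘ₗ expect) ⁻¹' valueTests) ?_
    (convex_valueTests.linear_preimage _) hg
  rintro _ (rfl | ⟨s, rfl⟩)
  · rw [Set.mem_preimage, map_zero]
    exact zero_mem_valueTests
  · have h := prob_mem_valueTests (V :: s)
    simp only [prob_value_cons] at h
    rw [funext fun U : Value => prob_eq_expect (U.apply V) s] at h
    exact h

theorem mem_Icc_of_mem_tests {f : Program → ℝ} (hf : f ∈ tests) (M : Program) :
    f M ∈ Set.Icc (0 : ℝ) 1 := by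
  refine convexHull_min (t := (LinearMap.proj (R := ℝ) (φ := fun _ : Program => ℝ) M) ⁻¹'
    Set.Icc 0 1) ?_ ((convex_Icc _ _).linear_preimage _) hf
  rintro _ (rfl | rfl | ⟨s, rfl⟩)
  · simp
  · simp
  · exact prob_mem_Icc M s

theorem abs_sub_le_traceDist_of_mem_tests {f : Program → ℝ} (hf : f ∈ tests) (M N : Program) :
    |f M - f N| ≤ traceDist M N := by
  -- Without boundedness the real supremum would be a default value and bound nothing.
  have hbdd : BddAbove (Set.range fun s : Trace => |prob M s - prob N s|) := by
    refine ⟨1, ?_⟩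
    rintro _ ⟨s, rfl⟩
    have h1 := prob_mem_Icc M s
    have h2 := prob_mem_Icc N s
    exact abs_sub_le_iff.2 ⟨by linarith [h1.2, h2.1], by linarith [h1.1, h2.2]⟩
  have h0 : 0 ≤ traceDist M N := (abs_nonneg _).trans (le_ciSup hbdd [])
  have h := convexHull_min (t := (LinearMap.proj (R := ℝ) (φ := fun _ : Program => ℝ) M -
    LinearMap.proj (R := ℝ) (φ := fun _ : Program => ℝ) N) ⁻¹'
      Set.Icc (-traceDist M N) (traceDist M N)) ?_ ((convex_Icc _ _).linear_preimage _) hf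
  · exact abs_le.2 h
  rintro _ (rfl | rfl | ⟨s, rfl⟩)
  · simpa using h0
  · simpa using h0
  · exact abs_le.1 (le_ciSup hbdd s)

theorem sum_sem_mem_tests (L : Program) {f : Value → Program → ℝ}
    (hf : ∀ V ∈ (sem L).support, f V ∈ tests) :
    (fun M => expect (fun V => f V M) L) ∈ tests := by
  have h := (sem_spec L).subdistribution
  have := convex_tests.sum_smul_mem_of_sum_le_one zero_mem_tests (fun V _ => h.1 V) h.2 hf
  convert this using 1
  funext M
  simp [expect_apply]

theorem sum_sem_mem_valueTests (L : Program) {f : Value → Value → ℝ}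
    (hf : ∀ V ∈ (sem L).support, f V ∈ valueTests) :
    (fun U => expect (fun V => f V U) L) ∈ valueTests := by
  have h := (sem_spec L).subdistribution
  have := convex_valueTests.sum_smul_mem_of_sum_le_one zero_mem_valueTests (fun V _ => h.1 V) h.2 hf
  convert this using 1
  funext M
  simp [expect_apply]

/-! ### Substitution and contexts -/

theorem Term.Affine.subst_congr {Γ : Finset ℕ} {M : Term} (h : M.Affine Γ) :
    ∀ {k : ℕ}, k ∉ Γ → ∀ V W : Term, Term.subst V k M = Term.subst W k M := by
  induction h with
  | var hn =>
    intro k hk V W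
    have : ¬ _ = k := fun e => hk (e ▸ hn)
    simp only [Term.subst, this, if_false]
  | lam _ ih =>
    intro k hk V W
    simp only [Term.subst]
    rw [ih (by simpa using hk) V W]
  | app _ _ _ ihM ihN =>
    intro k hk V W
    rw [Finset.mem_union, not_or] at hk
    simp only [Term.subst]
    rw [ihM hk.1 V W, ihN hk.2 V W]
  | choice _ _ ihM ihN =>
    intro k hk V W
    simp only [Term.subst]
    rw [ihM hk V W, ihN hk V W]
  | omega => intro k _ V W; rfl

theorem Term.Affine.subst_eq_self {Γ : Finset ℕ} {M : Term} (h : M.Affine Γ) (V : Term) :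
    ∀ {k : ℕ}, (∀ n ∈ Γ, n < k) → Term.subst V k M = M := by
  induction h with
  | var hn =>
    intro k hk
    have := hk _ hn
    simp only [Term.subst, this.ne, this.not_gt, if_false]
  | lam _ ih =>
    intro k hk
    simp only [Term.subst]
    rw [ih]
    simpa using hk
  | app _ _ _ ihM ihN =>
    intro k hk
    simp only [Term.subst]
    rw [ihM fun n hn => hk n (Finset.mem_union_left _ hn),
      ihN fun n hn => hk n (Finset.mem_union_right _ hn)]
  | choice _ _ ihM ihN =>
    intro k hk
    simp only [Term.subst]
    rw [ihM hk, ihN hk]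
  | omega => intro k _; rfl

theorem insert_zero_image_succ_erase_subset (Γ : Finset ℕ) (k : ℕ) :
    ((insert 0 (Γ.image Nat.succ)).erase (k + 1)).image (dropVar (k + 1)) ⊆
      insert 0 (((Γ.erase k).image (dropVar k)).image Nat.succ) := by
  intro a ha
  simp only [Finset.mem_image, Finset.mem_erase, Finset.mem_insert] at ha ⊢
  obtain ⟨b, ⟨hb, rfl | ⟨c, hc, rfl⟩⟩, rfl⟩ := ha
  · left; simp [dropVar]
  · right
    refine ⟨dropVar k c, ⟨c, ⟨fun e => hb (by simp [e]), hc⟩, rfl⟩, ?_⟩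
    simp only [dropVar]; split_ifs <;> omega

theorem disjoint_erase_image_dropVar {Γ Δ : Finset ℕ} (h : Disjoint Γ Δ) (k : ℕ) :
    Disjoint ((Γ.erase k).image (dropVar k)) ((Δ.erase k).image (dropVar k)) := by
  rw [Finset.disjoint_left]
  intro a h1 h2
  simp only [Finset.mem_image, Finset.mem_erase] at h1 h2
  obtain ⟨b, ⟨hb, hb1⟩, rfl⟩ := h1
  obtain ⟨c, ⟨hc, hc1⟩, e⟩ := h2
  have : c = b := by
    simp only [dropVar] at e; split_ifs at e <;> omega
  exact Finset.disjoint_left.1 h hb1 (this ▸ hc1)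

namespace RawCtx

/-- The hole weighs `1` whatever fills it, so the measure does not depend on the program. The
maximum at a choice lets both branches receive a substituted value at the cost of one. -/
def size : RawCtx → ℕ
  | .hole => 1
  | .term M => M.size
  | .lam C => C.size + 1
  | .appLeft C M => C.size + M.size + 1
  | .appRight M C => M.size + C.size + 1
  | .choice C C' => max C.size C'.size + 1

theorem Affine.mono {Γ : Finset ℕ} {C : RawCtx} (h : C.Affine Γ) :
    ∀ {Δ : Finset ℕ}, Γ ⊆ Δ → C.Affine Δ := by
  induction h with
  | hole => intro Δ _; exact .hole
  | term h => intro Δ hΔ; exact .term (h.mono hΔ)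
  | lam _ ih =>
    intro Δ hΔ
    exact .lam (ih (Finset.insert_subset_insert _ (Finset.image_subset_image hΔ)))
  | @appLeft Γ₁ Γ₂ C M hd _ hM ih =>
    intro Δ hΔ
    have h2 : Γ₂ ⊆ Δ := fun a ha => hΔ (Finset.mem_union_right _ ha)
    have h1 : Γ₁ ⊆ Δ \ Γ₂ := fun a ha => Finset.mem_sdiff.2
      ⟨hΔ (Finset.mem_union_left _ ha), Finset.disjoint_left.1 hd ha⟩
    have h3 := Affine.appLeft Finset.sdiff_disjoint (ih h1) hM
    rwa [Finset.sdiff_union_of_subset h2] at h3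
  | @appRight Γ₁ Γ₂ M C hd hM _ ih =>
    intro Δ hΔ
    have h2 : Γ₁ ⊆ Δ := fun a ha => hΔ (Finset.mem_union_left _ ha)
    have h1 : Γ₂ ⊆ Δ \ Γ₁ := fun a ha => Finset.mem_sdiff.2
      ⟨hΔ (Finset.mem_union_right _ ha), Finset.disjoint_right.1 hd ha⟩
    have h3 := Affine.appRight Finset.disjoint_sdiff hM (ih h1)
    rwa [Finset.union_sdiff_of_subset h2] at h3
  | choice _ _ ih ih' => intro Δ hΔ; exact .choice (ih hΔ) (ih' hΔ)

/-- Substitution of a closed term for a variable of a context. -/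
def subst (V : Term) : ℕ → RawCtx → RawCtx
  | _, .hole => .hole
  | k, .term M => .term (Term.subst V k M)
  | k, .lam C => .lam (subst V (k + 1) C)
  | k, .appLeft C M => .appLeft (subst V k C) (Term.subst V k M)
  | k, .appRight M C => .appRight (Term.subst V k M) (subst V k C)
  | k, .choice C C' => .choice (subst V k C) (subst V k C')

theorem Affine.subst {Γ : Finset ℕ} {C : RawCtx} (h : C.Affine Γ) {V : Term} (hV : V.Affine ∅) :
    ∀ k : ℕ, (C.subst V k).Affine ((Γ.erase k).image (dropVar k)) := by
  induction h with
  | hole => intro k; exact .hole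
  | term h => intro k; exact .term (h.subst hV k)
  | lam _ ih =>
    intro k
    exact .lam ((ih (k + 1)).mono (insert_zero_image_succ_erase_subset _ k))
  | appLeft hd _ hM ih =>
    intro k
    rw [Finset.erase_union_distrib, Finset.image_union]
    exact .appLeft (disjoint_erase_image_dropVar hd k) (ih k) (hM.subst hV k)
  | appRight hd hM _ ih =>
    intro k
    rw [Finset.erase_union_distrib, Finset.image_union]
    exact .appRight (disjoint_erase_image_dropVar hd k) (hM.subst hV k) (ih k)
  | choice _ _ ih ih' => intro k; exact .choice (ih k) (ih' k)

theorem Affine.size_subst {Γ : Finset ℕ} {C : RawCtx} (V : Term) (h : C.Affine Γ) :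
    ∀ k : ℕ, (C.subst V k).size ≤ C.size + (if k ∈ Γ then V.size else 0) := by
  induction h with
  | hole => intro k; simp [RawCtx.subst, size]
  | term h => intro k; exact h.size_subst V k
  | lam _ ih =>
    intro k
    have := ih (k + 1)
    simp only [Finset.mem_insert, Finset.mem_image, Nat.succ_eq_add_one, Nat.add_right_cancel_iff,
      exists_eq_right, Nat.add_eq_zero_iff, one_ne_zero, and_false, false_or] at this
    simp only [RawCtx.subst, size]; omega
  | @appLeft Γ₁ Γ₂ C M hd _ hM ih =>
    intro k
    have h1 := ih k
    have h2 := hM.size_subst V k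
    have h3 : ¬ (k ∈ Γ₁ ∧ k ∈ Γ₂) := fun h => Finset.disjoint_left.1 hd h.1 h.2
    simp only [RawCtx.subst, size, Finset.mem_union]
    by_cases hk1 : k ∈ Γ₁ <;> by_cases hk2 : k ∈ Γ₂ <;> simp_all <;> omega
  | @appRight Γ₁ Γ₂ M C hd hM _ ih =>
    intro k
    have h1 := ih k
    have h2 := hM.size_subst V k
    have h3 : ¬ (k ∈ Γ₁ ∧ k ∈ Γ₂) := fun h => Finset.disjoint_left.1 hd h.1 h.2
    simp only [RawCtx.subst, size, Finset.mem_union]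
    by_cases hk1 : k ∈ Γ₁ <;> by_cases hk2 : k ∈ Γ₂ <;> simp_all <;> omega
  | choice _ _ ih ih' =>
    intro k
    have h1 := ih k
    have h2 := ih' k
    simp only [RawCtx.subst, size]; omega

theorem fill_subst (V : Term) {P : Term} (hP : P.Affine ∅) (C : RawCtx) :
    ∀ k : ℕ, (C.subst V k).fill P = Term.subst V k (C.fill P) := by
  induction C with
  | hole => intro k; exact (hP.subst_eq_self V (by simp)).symm
  | term M => intro k; rfl
  | lam C ih => intro k; simp only [RawCtx.subst, fill, Term.subst, ih]
  | appLeft C M ih => intro k; simp only [RawCtx.subst, fill, Term.subst, ih]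
  | appRight M C ih => intro k; simp only [RawCtx.subst, fill, Term.subst, ih]
  | choice C C' ih ih' => intro k; simp only [RawCtx.subst, fill, Term.subst, ih, ih']

end RawCtx

/-- A closed context may be substituted for a variable of an affine term. -/
theorem Term.Affine.exists_ctx_subst {Γ : Finset ℕ} {A : Term} (h : A.Affine Γ) {D : RawCtx}
    (hD : D.Affine ∅) : ∀ k : ℕ, ∃ C : RawCtx, C.Affine ((Γ.erase k).image (dropVar k)) ∧
      C.size ≤ A.size + (if k ∈ Γ then D.size else 0) ∧
      ∀ P : Term, C.fill P = Term.subst (D.fill P) k A := by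
  induction h with
  | @var Γ n hn =>
    intro k
    by_cases hk : n = k
    · subst hk
      exact ⟨D, hD.mono (Finset.empty_subset _), by simp [hn], fun P => by simp [Term.subst]⟩
    · have h : ∀ V, Term.subst V k (.var n) = .var (dropVar k n) := fun V => by
        simp only [Term.subst, dropVar, hk, if_false]; split_ifs <;> rfl
      exact ⟨.term (.var (dropVar k n)),
        .term (.var (Finset.mem_image_of_mem _ (Finset.mem_erase.2 ⟨hk, hn⟩))),
        by simp [RawCtx.size, Term.size], fun P => (h _).symm⟩
  | @lam Γ M _ ih =>
    intro k
    obtain ⟨C, hC, sC, fC⟩ := ih (k + 1)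
    refine ⟨.lam C, .lam (hC.mono (insert_zero_image_succ_erase_subset _ k)), ?_, fun P => ?_⟩
    · simp only [Finset.mem_insert, Finset.mem_image, Nat.succ_eq_add_one,
        Nat.add_right_cancel_iff, exists_eq_right, Nat.add_eq_zero_iff, one_ne_zero, and_false,
        false_or] at sC
      simp only [RawCtx.size, Term.size]; omega
    · simp only [RawCtx.fill, Term.subst, fC]
  | @app Γ₁ Γ₂ M N hd hM hN ihM ihN =>
    intro k
    rw [Finset.erase_union_distrib, Finset.image_union]
    have hd' := disjoint_erase_image_dropVar hd k
    -- By disjointness the variable occurs on at most one side, which receives the hole; contexts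
    -- have no application with holes on both sides.
    by_cases hk : k ∈ Γ₁
    · have hk2 : k ∉ Γ₂ := Finset.disjoint_left.1 hd hk
      obtain ⟨C, hC, sC, fC⟩ := ihM k
      have sN := hN.size_subst .omega k
      -- In `N` the variable `k` does not occur, so `omega` is an arbitrary closed filler:
      -- substitution only renumbers variables.
      refine ⟨.appLeft C (Term.subst .omega k N), .appLeft hd' hC (hN.subst .omega k), ?_,
        fun P => ?_⟩
      · simp only [hk, hk2, if_true, if_false, Finset.mem_union, true_or] at sC sN ⊢
        simp only [RawCtx.size, Term.size]; omega
      · simp only [RawCtx.fill, Term.subst, fC]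
        rw [hN.subst_congr hk2]
    · obtain ⟨C, hC, sC, fC⟩ := ihN k
      have sM := hM.size_subst .omega k
      refine ⟨.appRight (Term.subst .omega k M) C, .appRight hd' (hM.subst .omega k) hC, ?_,
        fun P => ?_⟩
      · simp only [hk, if_false, Finset.mem_union, false_or] at sC sM ⊢
        simp only [RawCtx.size, Term.size]; omega
      · simp only [RawCtx.fill, Term.subst, fC]
        rw [hM.subst_congr hk]
  | @choice Γ M N _ _ ihM ihN =>
    intro k
    obtain ⟨C, hC, sC, fC⟩ := ihM k
    obtain ⟨C', hC', sC', fC'⟩ := ihN k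
    refine ⟨.choice C C', .choice hC hC', ?_, fun P => ?_⟩
    · simp only [RawCtx.size, Term.size]; omega
    · simp only [RawCtx.fill, Term.subst, fC, fC']
  | omega =>
    intro k
    exact ⟨.term .omega, .term .omega, by simp [RawCtx.size], fun P => rfl⟩

/-! ### Value contexts -/

/-- A value context `λx. body`. -/
structure ValueCtx : Type where
  body : RawCtx
  affine : body.Affine {0}

namespace ValueCtx

def fill (K : ValueCtx) (M : Program) : Value := ⟨K.body.fill M.1, K.affine.fill M.2⟩

theorem exists_ctx_fill_apply (K : ValueCtx) (V : Value) :
    ∃ C : Ctx, C.1.size ≤ K.body.size + V.toProgram.1.size ∧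
      ∀ M, C.fill M = (K.fill M).apply V := by
  have h := K.affine.subst V.toProgram.2 0
  refine ⟨⟨K.body.subst V.toProgram.1 0, by simpa using h⟩, ?_, fun M => ?_⟩
  · simpa using K.affine.size_subst V.toProgram.1 0
  · exact Subtype.ext (RawCtx.fill_subst _ M.2 _ _)

theorem exists_ctx_apply_fill (K : ValueCtx) (U : Value) :
    ∃ C : Ctx, C.1.size ≤ U.body.size + (K.body.size + 1) ∧
      ∀ M, C.fill M = U.apply (K.fill M) := by
  have hK : (RawCtx.lam K.body).Affine ∅ := .lam (by simpa using K.affine)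
  obtain ⟨C, hC, sC, fC⟩ := U.affine.exists_ctx_subst hK 0
  exact ⟨⟨C, by simpa using hC⟩, by simpa [RawCtx.size] using sC, fun M => Subtype.ext (fC M.1)⟩

end ValueCtx

/-- The context is the body of `U` with the hole in place of the bound variable. -/
theorem Value.exists_ctx_apply (U : Value) :
    ∃ C : Ctx, C.1.size ≤ U.body.size + 1 ∧ ∀ V, C.fill V.toProgram = U.apply V := by
  obtain ⟨C, hC, sC, fC⟩ := U.affine.exists_ctx_subst .hole 0
  exact ⟨⟨C, by simpa using hC⟩, by simpa [RawCtx.size] using sC, fun V => Subtype.ext (fC V.toProgram.1)⟩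

/-! ### Contexts yield tests -/

/-- A function on values is a test on values up to size `n` if it is a test and remains one when
precomposed with a value context of size at most `n`. -/
structure IsTestUpTo (n : ℕ) (g : Value → ℝ) : Prop where
  mem : g ∈ valueTests
  fill_mem : ∀ K : ValueCtx, K.body.size + 1 ≤ n → (fun M => g (K.fill M)) ∈ tests

theorem IsTestUpTo.mono {m n : ℕ} {g : Value → ℝ} (h : IsTestUpTo n g) (hmn : m ≤ n) :
    IsTestUpTo m g :=
  ⟨h.mem, fun K hK => h.fill_mem K (hK.trans hmn)⟩

theorem expect_fill_mem_tests (n : ℕ) : ∀ (C : Ctx) (g : Value → ℝ), C.1.size ≤ n →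
    IsTestUpTo n g → (fun M => expect g (C.fill M)) ∈ tests := by
  induction n using Nat.strong_induction_on with
  | _ n ih =>
  rintro ⟨C, hC⟩ g hn hg
  have ih' : ∀ m < n, ∀ C : Ctx, C.1.size ≤ m → (fun M => expect g (C.fill M)) ∈ tests :=
    fun m hm C hC => ih m hm C g hC (hg.mono hm.le)
  -- The index is generalized because case analysis cannot unify `∅` with the union in the
  -- application rules.
  obtain ⟨Γ, hΓ, hC₀⟩ : ∃ Γ : Finset ℕ, ∅ = Γ ∧ C.Affine Γ := ⟨∅, rfl, hC⟩
  cases hC₀ with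
  | hole => exact expect_mem_tests hg.mem
  | @term _ M hM =>
    subst hΓ
    exact const_mem_tests (mem_Icc_of_mem_tests (expect_mem_tests hg.mem) ⟨M, hM⟩)
  | @lam _ C hC =>
    subst hΓ
    let K : ValueCtx := ⟨C, by simpa using hC⟩
    convert hg.fill_mem K hn using 2 with M
    exact expect_toProgram g (K.fill M)
  | @appLeft Γ Δ C L hd hC hL =>
    obtain ⟨rfl, rfl⟩ := Finset.union_eq_empty.1 hΓ.symm
    simp only [RawCtx.size] at hn
    let L' : Program := ⟨L, hL⟩
    -- The new function of `U` averages over the values `V` of `L`. With `U = K[M]`, each `K[M]`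
    -- applied to `V` is a context of size at most `C.size + L.size`, one less than the application.
    have key := ih C.size (by omega) ⟨C, hC⟩
      (fun U => expect (fun V => expect g (U.apply V)) L') le_rfl
      ⟨sum_sem_mem_valueTests L' fun V _ => expect_apply_mem_valueTests hg.mem V, fun K hK =>
        sum_sem_mem_tests L' fun V hV => by
          obtain ⟨C', sC', fC'⟩ := K.exists_ctx_fill_apply V
          have hV' := size_le_of_mem_support_sem hV
          simp only [← fC']
          exact ih' (C.size + L.size) (by omega) C'
            (by simp only [Value.toProgram, Term.size, L'] at sC' hV'; omega)⟩
    convert key using 2 with M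
    exact expect_app_left g (Ctx.fill ⟨C, hC⟩ M) L'
  | @appRight Γ Δ L C hd hL hC =>
    obtain ⟨rfl, rfl⟩ := Finset.union_eq_empty.1 hΓ.symm
    simp only [RawCtx.size] at hn
    let L' : Program := ⟨L, hL⟩
    -- Averaging over the values `U` of `L` leaves, for each `U`, the function `V ↦ expect g
    -- (U.apply V)` to be tested on `C[M]`.
    have key := sum_sem_mem_tests L'
      (f := fun U M => expect (fun V => expect g (U.apply V)) (Ctx.fill ⟨C, hC⟩ M)) fun U hU => by
        have hU' := size_le_of_mem_support_sem hU
        simp only [L'] at hU'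
        refine ih C.size (by omega) ⟨C, hC⟩ _ le_rfl ⟨?_, fun K hK => ?_⟩
        -- Here `V` is the argument, so no trace gives this function directly: the body of `U` is
        -- read as a context around `V`, smaller than the application, and the induction hypothesis
        -- makes it a test.
        · obtain ⟨C', sC', fC'⟩ := U.exists_ctx_apply
          simp only [← fC']
          exact comp_toProgram_mem_valueTests (ih' L.size (by omega) C' (by omega))
        · obtain ⟨C', sC', fC'⟩ := K.exists_ctx_apply_fill U
          simp only [← fC']
          exact ih' (L.size + C.size) (by omega) C' (by omega)
    convert key using 2 with M
    exact expect_app_left g L' (Ctx.fill ⟨C, hC⟩ M)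
  | @choice _ C C' hC hC' =>
    subst hΓ
    simp only [RawCtx.size] at hn
    have h1 := ih' C.size (by omega) ⟨C, hC⟩ le_rfl
    have h2 := ih' C'.size (by omega) ⟨C', hC'⟩ le_rfl
    convert convex_tests h1 h2 (a := 1 / 2) (b := 1 / 2) (by norm_num) (by norm_num)
      (by norm_num) using 1
    funext M
    exact expect_choice g (Ctx.fill ⟨C, hC⟩ M) (Ctx.fill ⟨C', hC'⟩ M)

/-- Induction on the trace. The size bound must be arbitrary: consuming the first value `V`
substitutes it into the body, and the size of `V` is not controlled. -/
theorem isTestUpTo_prob (s : Trace) :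
    ∀ n, IsTestUpTo n fun V : Value => prob V.toProgram s := by
  induction s with
  | nil =>
    refine fun n => ⟨prob_mem_valueTests [], fun K _ => ?_⟩
    simp only [prob_value_nil]
    exact one_mem_tests
  | cons V s ih =>
    refine fun n => ⟨prob_mem_valueTests (V :: s), fun K _ => ?_⟩
    obtain ⟨C, -, fC⟩ := K.exists_ctx_fill_apply V
    simp only [prob_value_cons, ← fC]
    rw [funext fun M => prob_eq_expect (C.fill M) s]
    exact expect_fill_mem_tests _ C _ le_rfl (ih _)

/-- The acceptance probability of `C[M]` is a test, as a function of `M`. -/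
theorem prob_fill_mem_tests (C : Ctx) (s : Trace) : (fun M => prob (C.fill M) s) ∈ tests := by
  rw [funext fun M => prob_eq_expect (C.fill M) s]
  exact expect_fill_mem_tests _ C _ le_rfl (isTestUpTo_prob s _)

end AffineLambda

theorem mainTheorem1 (M N : AffineLambda.Program) (C : AffineLambda.Ctx) :
    AffineLambda.traceDist (C.fill M) (C.fill N) ≤ AffineLambda.traceDist M N :=
  ciSup_le fun s =>
    AffineLambda.abs_sub_le_traceDist_of_mem_tests (AffineLambda.prob_fill_mem_tests C s) M N
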